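/- All groups are finite. Let $G$ be a finite group and $p$ a prime. For a subgroup $H$ of $G$ let $H^G$ denote its normal closure in $G$. A chief factor of $G$ is a quotient $L/K$, where $K<L$ are normal subgroups of $G$ and no normal subgroup of $G$ lies strictly between $K$ and $L$; it lies below a normal subgroup $N$ of $G$ if $L\le N$. Say that $H$ satisfies the $\mathscr{L}$-$\Pi$-property in $G$ if, for every normal subgroup $K$ of $G$ such that $H^G/K$ is a chief factor of $G$ (that is, for every maximal $G$-invariant subgroup $K$ of $H^G$), every prime divisor of the index $|G/K : N_{G/K}(HK/K)|$ divides $|HK/K|$. (This holds vacuously if $H=1$.) A group is called quaternion-free if it has no section $A/B$ (with $B\trianglelefteq A$) isomorphic to the quaternion group of order $8$. The supersoluble hypercenter $Z_{\mathfrak{U}}(G)$ is the product of all normal subgroups $N$ of $G$ such that every chief factor of $G$ below $N$ has prime order. Theorem. Let $P$ be a normal $p$-subgroup of $G$. Suppose that (1) every subgroup of $P$ of order $p$ satisfies the $\mathscr{L}$-$\Pi$-property in $G$; and (2) if $P$ is not quaternion-free, then moreover every cyclic subgroup of $P$ of order $4$ satisfies the $\mathscr{L}$-$\Pi$-property in $G$.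 Then $P\le Z_{\mathfrak{U}}(G)$. -/

import Mathlib

/-- `L / K` is a chief factor of `G`: `K < L` are normal subgroups of `G` and no normal subgroup
of `G` lies strictly between them. Equivalently, `K` is a maximal `G`-invariant subgroup of the
normal subgroup `L`. -/
structure IsChiefFactor {G : Type*} [Group G] (L K : Subgroup G) : Prop where
  normal_top : L.Normal
  normal_bot : K.Normal
  lt : K < L
  maximal : ∀ M : Subgroup G, M.Normal → K ≤ M → M ≤ L → M = K ∨ M = L

/-- The natural number `n` is a `π(X)`-number, where `π(X)` is the set of primes dividing `|X|`. -/
def IsPiNumberOf (X : Type*) (n : ℕ) : Prop :=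
  ∀ q : ℕ, q.Prime → q ∣ n → q ∣ Nat.card X

/-- The subgroup `H` satisfies the `𝓛`-`Π`-property in `G`: for every chief factor `H^G / K` of `G`,
where `H^G` is the normal closure of `H`, the index of the normalizer of `HK / K` in `G / K` is a
`π(HK / K)`-number. Here `HK / K` is the image of `H` in `G / K`. -/
def SatisfiesLPiProperty {G : Type*} [Group G] (H : Subgroup G) : Prop :=
  ∀ (K : Subgroup G) [K.Normal], IsChiefFactor (Subgroup.normalClosure (H : Set G)) K →
    IsPiNumberOf (H.map (QuotientGroup.mk' K))
      (Subgroup.normalizer (H.map (QuotientGroup.mk' K) : Set (G ⧸ K))).index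

/-- No section `A / B` of `X` (with `B` normal in `A ≤ X`) is isomorphic to the quaternion group of
order `8`. -/
def IsQuaternionFree (X : Type*) [Group X] : Prop :=
  ∀ (A : Subgroup X) (B : Subgroup A) [B.Normal], IsEmpty ((A ⧸ B) ≃* QuaternionGroup 2)

/-- The supersoluble hypercenter of `G`: the product (join) of all normal subgroups `H` of `G` such
that every chief factor `L / K` of `G` below `H` has prime order. -/
def supersolubleHypercenter (G : Type*) [Group G] : Subgroup G :=
  sSup {H : Subgroup G | H.Normal ∧
    ∀ L K : Subgroup G, IsChiefFactor L K → L ≤ H → (K.relIndex L).Prime}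

/-!
Induction on `|P|` shows more: every chief factor of `G` below `P` has prime order
(`HasPrimeChiefFactors P`). Let `P / N` be a chief factor. By induction all chief factors below a
normal subgroup `M < P` have prime order. If some such `M` is not contained in `N`, then
`P / N ≅ M / (M ∩ N)` has prime order. So assume that `N` contains every normal subgroup `M < P`;
then `P` is the normal closure of each of its elements outside `N`. Let `C` be the centralizer of
`N` in `G`.

If `[P, C] ≤ N`, the group `G` acts on `V = P / N` as an abelian group of exponent dividing `p - 1`.
Indeed, modulo the subgroup `D` of elements acting trivially on all chief factors below `N` it is
such a group, because those factors have order `p`. The elements of `D` of order prime to `p`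
centralize `N`, so they act trivially on `V`; hence `D` acts on `V` as a normal `p`-group, which
must be trivial on the irreducible module `V`. As `X ^ p - X` splits over the field with `p`
elements, each element of `G` is scalar on `V`, so `V` has order `p`
(`IsChiefFactor.relIndex_eq_of_commutator_le`).

Otherwise `[P, C] = P`, and the three subgroups lemma gives `[P, N] = 1`. So `P` has class at most
two, and `x ↦ x ^ e` is a homomorphism from `P` to `N`, where `e = p` for odd `p` and `e = 4` for
`p = 2`. It is `C`-invariant, hence trivial (`pow_eq_one_of_commutator_eq`). If `p = 2` and `P` is
quaternion-free, every coset of `N` contains an element of order at most two: otherwise squaring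
induces, modulo a subgroup of index two in `N`, a nonzero `C`-invariant quadratic form on `V`; it
takes the value `1` at no three points `x`, `y`, `x + y`, as `x` and `y` would generate a quaternion
group modulo that subgroup, and such a form vanishes (`quadratic_eq_zero_of_invariant`). In all
cases every coset of `N` in `P` outside `N` contains an element generating a subgroup `H` with the
`𝓛`-`Π`-property. For a coset centralized by a Sylow `p`-subgroup of `G / N`, the normalizer of
`HN / N` has an index that is both a power of `p` and prime to `p`, so `HN / N` is normal in `G / N`
and equals `P / N` (`IsChiefFactor.relIndex_eq_of_satisfiesLPiProperty`).
-/

/-! ### Chief factors of prime order -/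

section ChiefFactors

open scoped commutatorElement

variable {G : Type*} [Group G]

/-- Every chief factor of `G` below `N` has prime order. For normal `N` this says that `N` is one of
the subgroups whose join is the supersoluble hypercenter. -/
def HasPrimeChiefFactors (N : Subgroup G) : Prop :=
  ∀ L K : Subgroup G, IsChiefFactor L K → L ≤ N → (K.relIndex L).Prime

theorem sup_inf_eq_of_le {A B C : Subgroup G} [hB : B.Normal] (h : A ≤ C) :
    (A ⊔ B) ⊓ C = A ⊔ B ⊓ C := by
  apply le_antisymm
  · rintro x ⟨hx, hxC⟩
    obtain ⟨a, ha, b, hb, rfl⟩ := Subgroup.mem_sup_of_normal_right.mp hx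
    refine Subgroup.mul_mem_sup ha ⟨hb, ?_⟩
    exact (Subgroup.mul_mem_cancel_left C (h ha)).mp hxC
  · exact sup_le (le_inf le_sup_left h) (inf_le_inf_right _ le_sup_right)

/-- The second isomorphism theorem for chief factors: if `L = KM`, then `M / (K ∩ M)` is a chief
factor because `L / K` is. -/
theorem IsChiefFactor.inf_of_sup_eq {L K M : Subgroup G} (h : IsChiefFactor L K)
    (hM : M.Normal) (hKM : K ⊔ M = L) : IsChiefFactor M (K ⊓ M) where
  normal_top := hM
  normal_bot := by have := h.normal_bot; infer_instance
  lt := by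
    refine lt_of_le_of_ne inf_le_right fun he => h.lt.ne ?_
    rw [← hKM, left_eq_sup, ← inf_eq_right, he]
  maximal := by
    intro M' hM' h1 h2
    have := h.normal_bot
    have key : (M' ⊔ K) ⊓ M = M' := by
      rw [sup_inf_eq_of_le h2, sup_eq_left.mpr h1]
    rcases h.maximal (M' ⊔ K) inferInstance le_sup_right
        (hKM ▸ sup_le (h2.trans le_sup_right) le_sup_left) with h3 | h3
    · left
      rw [← key, h3]
    · right
      rw [← key, h3, inf_eq_right, ← hKM]
      exact le_sup_right

theorem IsChiefFactor.relIndex_inf_of_sup_eq {L K M : Subgroup G} (h : IsChiefFactor L K)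
    (hKM : K ⊔ M = L) : (K ⊓ M).relIndex M = K.relIndex L := by
  have := h.normal_bot
  rw [Subgroup.inf_relIndex_right, ← hKM, Subgroup.relIndex_sup_left]

/-- The part of the Jordan–Hölder theorem needed here: a chief factor below `P` is isomorphic
either to a chief factor below `N` or to the chief factor `P / N`. -/
theorem HasPrimeChiefFactors.of_isChiefFactor {P N : Subgroup G} (hN : HasPrimeChiefFactors N)
    (h : IsChiefFactor P N) (hp : (N.relIndex P).Prime) : HasPrimeChiefFactors P := by
  intro L K hLK hLP
  have := h.normal_bot
  have := hLK.normal_bot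
  have := hLK.normal_top
  rcases hLK.maximal (K ⊔ L ⊓ N) inferInstance le_sup_left (sup_le hLK.lt.le inf_le_left) with
    h1 | h1
  · have h2 : L ⊓ N ≤ K := h1 ▸ le_sup_right
    have h3 : ¬ L ≤ K ⊔ N := fun h3 => hLK.lt.ne' <| by
      rw [← inf_eq_right.mpr h3, sup_inf_eq_of_le hLK.lt.le, inf_comm N L, h1]
    have h4 : K ⊔ N = N := by
      refine (h.maximal _ inferInstance le_sup_right
        (sup_le (hLK.lt.le.trans hLP) h.lt.le)).resolve_right fun h4 => h3 (h4 ▸ hLP)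
    have h5 : L ⊔ N = P := by
      refine (h.maximal _ inferInstance le_sup_right (sup_le hLP h.lt.le)).resolve_left fun h5 => ?_
      exact h3 (le_sup_left.trans (h5.le.trans le_sup_right))
    have h6 : K = N ⊓ L :=
      le_antisymm (le_inf (h4 ▸ le_sup_left) hLK.lt.le) (inf_comm L N ▸ h2)
    rw [h6, Subgroup.inf_relIndex_right, ← Subgroup.relIndex_sup_right, h5]
    exact hp
  · rw [← hLK.relIndex_inf_of_sup_eq h1]
    exact hN _ _ (hLK.inf_of_sup_eq inferInstance h1) inf_le_right

theorem exists_isChiefFactor [Finite G] {P : Subgroup G} (hP : P.Normal) (h : P ≠ ⊥) :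
    ∃ N, IsChiefFactor P N := by
  obtain ⟨N, hN, hmax⟩ := Set.Finite.exists_maximal (s := {N : Subgroup G | N.Normal ∧ N < P})
    (Set.toFinite _) ⟨⊥, inferInstance, bot_lt_iff_ne_bot.mpr h⟩
  refine ⟨N, hP, hN.1, hN.2, fun M hM h1 h2 => ?_⟩
  by_contra! hc
  exact hc.1 (le_antisymm (hmax ⟨hM, lt_of_le_of_ne h2 hc.2⟩ h1) h1)

/-- The elements of `G` that act trivially on every chief factor of `G` below `N`. -/
def chiefCentralizer (N : Subgroup G) : Subgroup G where
  carrier := {g | ∀ L K, IsChiefFactor L K → L ≤ N → ∀ x ∈ L, ⁅g, x⁆ ∈ K}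
  one_mem' := by
    intro L K _ _ x _
    simp
  mul_mem' := by
    intro g h hg hh L K hLK hLN x hx
    have e : ⁅g * h, x⁆ = g * ⁅h, x⁆ * g⁻¹ * ⁅g, x⁆ := by
      simp only [commutatorElement_def]; group
    rw [e]
    exact K.mul_mem (hLK.normal_bot.conj_mem _ (hh L K hLK hLN x hx) g) (hg L K hLK hLN x hx)
  inv_mem' := by
    intro g hg L K hLK hLN x hx
    have e : ⁅g⁻¹, x⁆ = g⁻¹ * ⁅g, x⁆⁻¹ * g⁻¹⁻¹ := by
      simp only [commutatorElement_def]; group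
    rw [e]
    exact hLK.normal_bot.conj_mem _ (K.inv_mem (hg L K hLK hLN x hx)) _

theorem pow_mul_eq_commutator_pow_mul {x y : G} (hy : Commute ⁅y, x⁆ y) (n : ℕ) :
    y ^ n * x = ⁅y, x⁆ ^ n * x * y ^ n := by
  induction n with
  | zero => simp
  | succ n ih =>
    have e : y * x = ⁅y, x⁆ * x * y := by simp [commutatorElement_def]
    calc y ^ (n + 1) * x = y * (y ^ n * x) := by rw [pow_succ', mul_assoc]
      _ = y * ⁅y, x⁆ ^ n * x * y ^ n := by rw [ih]; simp only [mul_assoc]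
      _ = ⁅y, x⁆ ^ n * (y * x) * y ^ n := by
        rw [← (hy.pow_left n).eq]; simp only [mul_assoc]
      _ = ⁅y, x⁆ ^ (n + 1) * x * y ^ (n + 1) := by
        rw [e, pow_succ ⁅y, x⁆, pow_succ' y]; simp only [mul_assoc]

/-- A coprime action on a normal `p`-subgroup that is trivial on all chief factors is trivial. -/
theorem commute_of_mem_chiefCentralizer [Finite G] {p : ℕ} (hp : p.Prime) {N : Subgroup G}
    (hN : N.Normal) (hNp : IsPGroup p N) {d : G} (hd : d ∈ chiefCentralizer N)
    (hdp : ¬ p ∣ orderOf d) {n : G} (hn : n ∈ N) : Commute d n := by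
  have := Fact.mk hp
  induction hc : Nat.card N using Nat.strong_induction_on generalizing N n with
  | _ c ih =>
  by_cases hb : N = ⊥
  · subst hb
    rw [Subgroup.mem_bot.mp hn]
    exact Commute.one_right d
  obtain ⟨K, hK⟩ := exists_isChiefFactor hN hb
  have hlt : Nat.card K < c := hc ▸ Set.Finite.card_lt_card (Set.toFinite _) hK.lt
  have hk : ⁅d, n⁆ ∈ K := hd N K hK le_rfl n hn
  have hdk : Commute d ⁅d, n⁆ := ih _ hlt hK.normal_bot (hNp.to_le hK.lt.le)
    (fun L M h1 h2 => hd L M h1 (h2.trans hK.lt.le)) hk rfl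
  -- Conjugation by `d` multiplies `n` by `⁅d, n⁆`, an element of `p`-power order fixed by `d`.
  have h1 : ⁅d, n⁆ ^ orderOf d = 1 := by
    have := pow_mul_eq_commutator_pow_mul hdk.symm (orderOf d)
    simpa [pow_orderOf_eq_one] using this.symm
  obtain ⟨k, hk2⟩ := IsPGroup.iff_orderOf.mp hNp ⟨_, hK.lt.le hk⟩
  have h2 : orderOf ⁅d, n⁆ = p ^ k := by rw [← hk2, Subgroup.orderOf_mk]
  have h3 : orderOf ⁅d, n⁆ = 1 := by
    refine Nat.Coprime.eq_one_of_dvd ?_ (orderOf_dvd_of_pow_eq_one h1)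
    rw [h2]
    exact Nat.Coprime.pow_left _ ((Nat.Prime.coprime_iff_not_dvd hp).mpr hdp)
  exact commutatorElement_eq_one_iff_commute.mp (orderOf_eq_one_iff.mp h3)

end ChiefFactors

/-! ### Minimal normal `p`-subgroups -/

section MinimalNormal

open scoped commutatorElement

variable {G : Type*} [Group G]

/-- `V` is a minimal normal subgroup of `G`. -/
structure IsMinimalNormal (V : Subgroup G) : Prop where
  normal : V.Normal
  ne_bot : V ≠ ⊥
  minimal : ∀ M : Subgroup G, M.Normal → M ≤ V → M = ⊥ ∨ M = V

theorem exists_fixed_ne_one {p : ℕ} (hp : p.Prime) {V : Type*} [Group V] [Finite V] [Nontrivial V]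
    (hV : IsPGroup p V) {Q : Subgroup (MulAut V)} (hQ : IsPGroup p Q) :
    ∃ v : V, v ≠ 1 ∧ ∀ φ ∈ Q, φ v = v := by
  have := Fact.mk hp
  obtain ⟨b, hb, hne⟩ := hQ.exists_fixed_point_of_prime_dvd_card_of_fixed_point V
    (hV.card_eq_or_dvd.resolve_left Finite.one_lt_card.ne') (a := 1)
    (fun φ => map_one (φ : MulAut V))
  exact ⟨b, hne.symm, fun φ hφ => hb ⟨φ, hφ⟩⟩

theorem mem_ker_conjNormal_iff {V : Subgroup G} [V.Normal] {g : G} :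
    g ∈ (MulAut.conjNormal : G →* MulAut V).ker ↔ ∀ v ∈ V, Commute g v := by
  rw [MonoidHom.mem_ker, MulEquiv.ext_iff]
  simp [Subtype.ext_iff, mul_inv_eq_iff_eq_mul, Commute, SemiconjBy]

/-- A subgroup inducing a `p`-group of automorphisms on a nontrivial normal `p`-subgroup `V`
centralizes some nontrivial element of `V`. -/
theorem exists_commute_of_pow_commute [Finite G] {p : ℕ} (hp : p.Prime) {V D : Subgroup G}
    (hVn : V.Normal) (hV : IsPGroup p V) (hb : V ≠ ⊥)
    (hD : ∀ d ∈ D, ∃ k : ℕ, ∀ v ∈ V, Commute (d ^ p ^ k) v) :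
    ∃ v ∈ V, v ≠ 1 ∧ ∀ d ∈ D, Commute d v := by
  have : Nontrivial V := (Subgroup.nontrivial_iff_ne_bot V).mpr hb
  obtain ⟨v, hv1, hv⟩ := exists_fixed_ne_one hp hV
    (Q := D.map (MulAut.conjNormal : G →* MulAut V)) (by
      rintro ⟨_, d, hd, rfl⟩
      obtain ⟨k, hk⟩ := hD d hd
      refine ⟨k, Subtype.ext ?_⟩
      have := mem_ker_conjNormal_iff.mpr hk
      rw [MonoidHom.mem_ker, map_pow] at this
      simpa using this)
  refine ⟨v, v.2, by simpa using hv1, fun d hd => ?_⟩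
  have h := congrArg Subtype.val (hv _ ⟨d, hd, rfl⟩)
  rw [MulAut.conjNormal_apply, mul_inv_eq_iff_eq_mul] at h
  exact h

/-- A normal subgroup of `G` that acts on a minimal normal `p`-subgroup as a `p`-group acts
trivially. -/
theorem IsMinimalNormal.commute_of_pow_commute [Finite G] {p : ℕ} (hp : p.Prime) {V D : Subgroup G}
    (h : IsMinimalNormal V) (hV : IsPGroup p V) (hDn : D.Normal)
    (hD : ∀ d ∈ D, ∃ k : ℕ, ∀ v ∈ V, Commute (d ^ p ^ k) v) :
    ∀ d ∈ D, ∀ v ∈ V, Commute d v := by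
  have := h.normal
  obtain ⟨v, hvV, hv1, hv⟩ := exists_commute_of_pow_commute hp h.normal hV h.ne_bot hD
  have hC : V ⊓ Subgroup.centralizer (D : Set G) = V := by
    refine (h.minimal _ inferInstance inf_le_left).resolve_left fun hb => hv1 ?_
    rw [← Subgroup.mem_bot, ← hb]
    exact ⟨hvV, fun d hd => hv d hd⟩
  intro d hd w hw
  exact (inf_eq_left.mp hC hw) d hd

theorem IsMinimalNormal.commute [Finite G] {p : ℕ} (hp : p.Prime) {V : Subgroup G}
    (h : IsMinimalNormal V) (hV : IsPGroup p V) {v w : G} (hv : v ∈ V) (hw : w ∈ V) :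
    Commute v w := by
  refine h.commute_of_pow_commute hp hV h.normal (fun d hd => ?_) v hv w hw
  obtain ⟨k, hk⟩ := hV ⟨d, hd⟩
  refine ⟨k, fun v _ => ?_⟩
  rw [show d ^ p ^ k = 1 from congrArg Subtype.val hk]
  exact Commute.one_left v

theorem IsMinimalNormal.pow_eq_one [Finite G] {p : ℕ} (hp : p.Prime) {V : Subgroup G}
    (h : IsMinimalNormal V) (hV : IsPGroup p V) {v : G} (hv : v ∈ V) : v ^ p = 1 := by
  have := Fact.mk hp
  let W : Subgroup G :=
    { carrier := {x | x ∈ V ∧ x ^ p = 1}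
      one_mem' := ⟨V.one_mem, one_pow p⟩
      mul_mem' := fun {a b} ha hb =>
        ⟨V.mul_mem ha.1 hb.1, by rw [(h.commute hp hV ha.1 hb.1).mul_pow, ha.2, hb.2, one_mul]⟩
      inv_mem' := fun {a} ha => ⟨V.inv_mem ha.1, by rw [inv_pow, ha.2, inv_one]⟩ }
  have hWn : W.Normal :=
    ⟨fun x hx g => ⟨h.normal.conj_mem x hx.1 g, by rw [conj_pow, hx.2, mul_one, mul_inv_cancel]⟩⟩
  have hW : W = V := by
    refine (h.minimal W hWn fun x hx => hx.1).resolve_left fun hb => ?_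
    have : Nontrivial V := (Subgroup.nontrivial_iff_ne_bot V).mpr h.ne_bot
    obtain ⟨x, hx⟩ := exists_prime_orderOf_dvd_card' p
      (hV.card_eq_or_dvd.resolve_left Finite.one_lt_card.ne')
    have hxW : (x : G) ∈ W :=
      ⟨x.2, by rw [← hx, ← Subgroup.orderOf_coe]; exact pow_orderOf_eq_one _⟩
    rw [hb, Subgroup.mem_bot] at hxW
    rw [OneMemClass.coe_eq_one.mp hxW, orderOf_one] at hx
    exact hp.one_lt.ne hx
  exact (hW.ge hv).2

theorem IsMinimalNormal.card_eq_of_zpowers_normal [Finite G] {p : ℕ} (hp : p.Prime)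
    {V : Subgroup G} (h : IsMinimalNormal V) (hV : IsPGroup p V) {v : G} (hv : v ∈ V) (hv1 : v ≠ 1)
    (hn : (Subgroup.zpowers v).Normal) : Nat.card V = p := by
  rcases h.minimal _ hn (Subgroup.zpowers_le.mpr hv) with h1 | h1
  · exact absurd (Subgroup.zpowers_eq_bot.mp h1) hv1
  · have := Fact.mk hp
    rw [← h1, Nat.card_zpowers]
    exact orderOf_eq_prime (h.pow_eq_one hp hV hv) hv1

/-- The polynomial `X ^ p - X` splits over the field with `p` elements, so an endomorphism
annihilated by it has an eigenvector. -/
theorem exists_smul_eq_of_pow_eq {p : ℕ} [Fact p.Prime] {M : Type*} [AddCommGroup M]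
    [Module (ZMod p) M] [Finite M] [Nontrivial M] {T : Module.End (ZMod p) M} (hT : T ^ p = T) :
    ∃ v : M, v ≠ 0 ∧ ∃ k : ℕ, T v = k • v := by
  have hdvd : minpoly (ZMod p) T ∣ (Polynomial.X ^ p - Polynomial.X : Polynomial (ZMod p)) :=
    minpoly.dvd _ _ (by simp [hT])
  have hne : (Polynomial.X ^ p - Polynomial.X : Polynomial (ZMod p)) ≠ 0 :=
    FiniteField.X_pow_card_sub_X_ne_zero _ (Fact.out : p.Prime).one_lt
  obtain ⟨μ, hμ⟩ := ((GaloisField.splits_zmod_X_pow_sub_X p).of_dvd hne hdvd).exists_eval_eq_zero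
    (minpoly.degree_pos (Algebra.IsIntegral.isIntegral T)).ne'
  obtain ⟨v, hv⟩ := (Module.End.hasEigenvalue_of_isRoot hμ).exists_hasEigenvector
  refine ⟨v, hv.2, μ.val, ?_⟩
  rw [hv.apply_eq_smul, ← Nat.cast_smul_eq_nsmul (ZMod p), ZMod.natCast_zmod_val]

/-- An automorphism of order dividing `p - 1` of an elementary abelian `p`-group has an
eigenvector. -/
theorem exists_map_eq_pow {p : ℕ} (hp : p.Prime) {V : Type*} [CommGroup V] [Finite V]
    [Nontrivial V] (hV : ∀ v : V, v ^ p = 1) {φ : MulAut V} (hφ : φ ^ (p - 1) = 1) :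
    ∃ v : V, v ≠ 1 ∧ ∃ k : ℕ, φ v = v ^ k := by
  have := Fact.mk hp
  let _ : Module (ZMod p) (Additive V) := AddCommGroup.zmodModule (n := p) fun x => hV x.toMul
  let T : Module.End (ZMod p) (Additive V) :=
    AddMonoidHom.toZModLinearMap p (MonoidHom.toAdditive φ.toMonoidHom)
  have hTφ : ∀ n : ℕ, ∀ v : V, (T ^ n) (Additive.ofMul v) = Additive.ofMul ((φ ^ n) v) := by
    intro n
    induction n with
    | zero => intro v; rfl
    | succ n ih =>
      intro v
      rw [pow_succ, pow_succ]
      exact ih (φ v)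
  have hT : T ^ p = T := by
    refine LinearMap.ext fun v => ?_
    have hφp : φ ^ p = φ := by rw [← mul_pow_sub_one hp.ne_zero φ, hφ, mul_one]
    have h := hTφ p v.toMul
    rw [hφp] at h
    exact h
  have : Nontrivial (Additive V) := inferInstanceAs (Nontrivial V)
  exact exists_smul_eq_of_pow_eq hT

/-- A minimal normal `p`-subgroup on which `G` acts as an abelian group of exponent dividing
`p - 1` has order `p`: each element of `G` has an eigenvector, its eigenspace is normal in `G`, and
so it acts as a power map. -/
theorem IsMinimalNormal.card_eq_of_abelian_action [Finite G] {p : ℕ} (hp : p.Prime)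
    {V : Subgroup G} (h : IsMinimalNormal V) (hV : IsPGroup p V)
    (hcomm : ∀ g h : G, ∀ v ∈ V, Commute ⁅g, h⁆ v)
    (hpow : ∀ g : G, ∀ v ∈ V, Commute (g ^ (p - 1)) v) : Nat.card V = p := by
  have hVn := h.normal
  have : Nontrivial V := (Subgroup.nontrivial_iff_ne_bot V).mpr h.ne_bot
  let _ : CommGroup V :=
    { (inferInstance : Group V) with
      mul_comm := fun a b => Subtype.ext (h.commute hp hV a.2 b.2) }
  have key : ∀ g : G, ∃ k : ℕ, ∀ v ∈ V, g * v * g⁻¹ = v ^ k := by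
    intro g
    obtain ⟨v, hv1, k, hk⟩ := exists_map_eq_pow hp (V := V)
      (fun v => Subtype.ext (h.pow_eq_one hp hV v.2)) (φ := MulAut.conjNormal g) (by
        rw [← map_pow]
        exact mem_ker_conjNormal_iff.mpr (hpow g))
    have hk : g * v * g⁻¹ = (v : G) ^ k := by
      rw [← MulAut.conjNormal_apply, hk, Subgroup.coe_pow]
    let W : Subgroup G :=
      { carrier := {x | x ∈ V ∧ g * x * g⁻¹ = x ^ k}
        one_mem' := ⟨V.one_mem, by simp⟩
        mul_mem' := fun {a b} ha hb =>
          ⟨V.mul_mem ha.1 hb.1, by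
            rw [(h.commute hp hV ha.1 hb.1).mul_pow, ← ha.2, ← hb.2]; group⟩
        inv_mem' := fun {a} ha => ⟨V.inv_mem ha.1, by rw [inv_pow, ← ha.2]; group⟩ }
    have hWn : W.Normal := by
      refine ⟨fun x hx y => ⟨hVn.conj_mem x hx.1 y, ?_⟩⟩
      have hc : ⁅y⁻¹, g⁆ * (g * x * g⁻¹) * ⁅y⁻¹, g⁆⁻¹ = g * x * g⁻¹ := by
        rw [(hcomm y⁻¹ g _ (hVn.conj_mem x hx.1 g)).eq, mul_inv_cancel_right]
      calc g * (y * x * y⁻¹) * g⁻¹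
          = y * (⁅y⁻¹, g⁆ * (g * x * g⁻¹) * ⁅y⁻¹, g⁆⁻¹) * y⁻¹ := by
            simp only [commutatorElement_def]; group
        _ = (y * x * y⁻¹) ^ k := by rw [hc, hx.2, conj_pow]
    have hW : W = V := by
      refine (h.minimal W hWn fun x hx => hx.1).resolve_left fun hb => hv1 ?_
      rw [← OneMemClass.coe_eq_one, ← Subgroup.mem_bot, ← hb]
      exact ⟨v.2, hk⟩
    exact ⟨k, fun w hw => (hW.ge hw).2⟩
  obtain ⟨v, hvV, hv1⟩ := V.bot_or_exists_ne_one.resolve_left h.ne_bot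
  refine h.card_eq_of_zpowers_normal hp hV hvV hv1 ⟨?_⟩
  rintro _ ⟨n, rfl⟩ g
  obtain ⟨k, hk⟩ := key g
  change g * v ^ n * g⁻¹ ∈ _
  rw [hk _ (V.zpow_mem hvV n)]
  exact pow_mem (Subgroup.zpow_mem_zpowers _ _) _

/-- The automorphism group of a group of prime order `p` is abelian of exponent dividing `p - 1`. -/
theorem mulAut_of_card_prime {p : ℕ} (hp : p.Prime) {V : Type*} [Group V] (hV : Nat.card V = p)
    (φ ψ : MulAut V) : ⁅φ, ψ⁆ = 1 ∧ φ ^ (p - 1) = 1 := by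
  have := Fact.mk hp
  have := isCyclic_of_prime_card hV
  have e := IsCyclic.mulAutMulEquiv V
  rw [hV] at e
  constructor
  · rw [commutatorElement_eq_one_iff_mul_comm]
    exact e.injective (by rw [map_mul, map_mul, mul_comm])
  · exact e.injective (by rw [map_pow, map_one, ZMod.units_pow_card_sub_one_eq_one])

/-- The index of the normalizer of `⟨v⟩` is not divisible by `p` if `v` is centralized by a Sylow
`p`-subgroup, so `⟨v⟩` is normal as soon as this index has no prime divisor other than `p`. -/
theorem zpowers_normal_of_index_normalizer [Finite G] {p : ℕ} [Fact p.Prime] (S : Sylow p G) {v : G}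
    (hS : ∀ s ∈ S, Commute s v)
    (hi : ∀ q : ℕ, q.Prime → q ∣ (Subgroup.normalizer (Subgroup.zpowers v : Set G)).index →
      q = p) : (Subgroup.zpowers v).Normal := by
  rw [← Subgroup.normalizer_eq_top_iff, ← Subgroup.index_eq_one]
  by_contra hne
  obtain ⟨q, hq, hqd⟩ := Nat.exists_prime_and_dvd hne
  have hle : (S : Subgroup G) ≤ Subgroup.normalizer (Subgroup.zpowers v : Set G) := by
    intro s hs
    rw [Subgroup.mem_normalizer_iff_map_conj_eq, MonoidHom.map_zpowers]
    congr 1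
    simp [(hS s hs).eq]
  refine S.not_dvd_index ?_
  have := hi q hq hqd
  subst this
  exact hqd.trans (Subgroup.index_dvd_of_le hle)

end MinimalNormal

/-! ### Quaternion sections -/

section Quaternion

theorem not_isQuaternionFree_of_surjective {X : Type*} [Group X] {A : Subgroup X}
    {f : A →* QuaternionGroup 2} (hf : Function.Surjective f) : ¬ IsQuaternionFree X :=
  fun h => (h A f.ker).false (QuotientGroup.quotientKerEquivOfSurjective f hf)

theorem IsQuaternionFree.of_injective {X Y : Type*} [Group X] [Group Y] (hY : IsQuaternionFree Y)
    {f : X →* Y} (hf : Function.Injective f) : IsQuaternionFree X := by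
  intro A B _
  by_contra hne
  obtain ⟨e⟩ := not_isEmpty_iff.mp hne
  let g : A.map f →* QuaternionGroup 2 :=
    e.toMonoidHom.comp ((QuotientGroup.mk' B).comp (A.equivMapOfInjective f hf).symm.toMonoidHom)
  refine not_isQuaternionFree_of_surjective (f := g) ?_ hY
  exact e.surjective.comp ((QuotientGroup.mk'_surjective B).comp
    (A.equivMapOfInjective f hf).symm.surjective)

/-- Two elements `x` and `y` with `x ^ 2 = y ^ 2 = (x * y) ^ 2` of order `2` generate a quaternion
group of order `8`. -/
theorem exists_injective_quaternionGroup {X : Type*} [Group X] {x y : X} (hx : x ^ 2 ≠ 1)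
    (hx4 : x ^ 4 = 1) (hy : y ^ 2 = x ^ 2) (hxy : (x * y) ^ 2 = x ^ 2) :
    ∃ f : QuaternionGroup 2 →* X, Function.Injective f := by
  have hpow : ∀ m n : ℕ, (m : ZMod 4) = n → x ^ m = x ^ n := by
    intro m n h
    rw [ZMod.natCast_eq_natCast_iff] at h
    exact pow_eq_pow_iff_modEq.mpr (h.of_dvd (orderOf_dvd_of_pow_eq_one hx4))
  have h1 : x * y * x = y := by
    apply mul_right_cancel (b := y)
    rw [← pow_two, hy, ← hxy, pow_two]
    simp only [mul_assoc]
  have h2 : ∀ n : ℕ, x ^ n * y * x ^ n = y := by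
    intro n
    induction n with
    | zero => simp
    | succ n ih =>
      calc x ^ (n + 1) * y * x ^ (n + 1) = x ^ n * (x * y * x) * x ^ n := by
            nth_rewrite 2 [pow_succ']
            rw [pow_succ]
            simp only [mul_assoc]
        _ = y := by rw [h1, ih]
  have h3 : ∀ n : ℕ, x ^ n * y = y * x ^ (3 * n) := by
    intro n
    have h4 : x ^ (n + 3 * n) = 1 := by
      rw [← pow_zero x]
      exact hpow _ _ (by push_cast; generalize (n : ZMod 4) = m; revert m; decide)
    calc x ^ n * y = x ^ n * y * (x ^ n * x ^ (3 * n)) := by rw [← pow_add, h4, mul_one]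
      _ = y * x ^ (3 * n) := by rw [← mul_assoc, h2]
  let F : QuaternionGroup 2 → X
    | .a i => x ^ i.val
    | .xa i => y * x ^ i.val
  have hF : ∀ u v, F (u * v) = F u * F v := by
    rintro (i | i) (j | j)
    · change x ^ (i + j).val = x ^ i.val * x ^ j.val
      rw [← pow_add]
      exact hpow _ _ (by revert i j; decide)
    · change y * x ^ (j - i).val = x ^ i.val * (y * x ^ j.val)
      rw [← mul_assoc, h3, mul_assoc, ← pow_add]
      congr 1
      exact hpow _ _ (by revert i j; decide)
    · change y * x ^ (i + j).val = y * x ^ i.val * x ^ j.val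
      rw [mul_assoc, ← pow_add]
      congr 1
      exact hpow _ _ (by revert i j; decide)
    · change x ^ ((2 : ZMod 4) + j - i).val = y * x ^ i.val * (y * x ^ j.val)
      rw [mul_assoc, ← mul_assoc (x ^ i.val), h3, mul_assoc, ← pow_add, ← mul_assoc, ← pow_two y,
        hy, ← pow_add]
      exact hpow _ _ (by revert i j; decide)
  refine ⟨MonoidHom.mk' F hF, (injective_iff_map_eq_one _).mpr ?_⟩
  have h5 : orderOf x = 4 := by
    have : orderOf x = 2 ^ (1 + 1) :=
      orderOf_eq_prime_pow (by simpa using hx) (by simpa using hx4)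
    simpa using this
  rintro (i | i) hi
  · have hi : x ^ i.val = 1 := hi
    have hd := orderOf_dvd_of_pow_eq_one hi
    rw [h5] at hd
    have h0 : i.val = 0 := Nat.eq_zero_of_dvd_of_lt hd (ZMod.val_lt i)
    rw [(ZMod.val_eq_zero i).mp h0, QuaternionGroup.one_def]
  · have hi : y * x ^ i.val = 1 := hi
    have hc : Commute x y := by
      rw [eq_inv_of_mul_eq_one_left hi]
      exact ((Commute.refl x).pow_right _).inv_right
    exfalso
    apply hx
    rw [hc.eq, mul_assoc, ← pow_two] at h1
    exact mul_eq_left.mp h1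

theorem not_isQuaternionFree_of_quotient {X : Type*} [Group X] (M : Subgroup X) [M.Normal]
    {f : QuaternionGroup 2 →* X ⧸ M} (hf : Function.Injective f) : ¬ IsQuaternionFree X := by
  let e := MonoidHom.ofInjective hf
  let g : f.range.comap (QuotientGroup.mk' M) →* f.range :=
    (QuotientGroup.mk' M).subgroupComap f.range
  refine not_isQuaternionFree_of_surjective (f := e.symm.toMonoidHom.comp g) ?_
  exact e.symm.surjective.comp
    (MonoidHom.subgroupComap_surjective_of_surjective _ _ (QuotientGroup.mk'_surjective M))

/-- A quadratic form over the field with two elements that takes the value `1` at no three points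
`x`, `y`, `x * y` vanishes when it is invariant under a set of automorphisms that fix no nonzero
linear form: the linear forms `b x` with `f x = 1` all coincide, so they are invariant and vanish,
which makes `f` itself linear. The form lives on a group `P` that need not be abelian, and `hgen`
says that no proper subgroup of `P` contains all the elements `φ x * x⁻¹`. -/
theorem quadratic_eq_zero_of_invariant {P : Type*} [Group P] {f : P → ZMod 2} {b : P → P → ZMod 2}
    (hf : ∀ x y, f (x * y) = f x + f y + b x y)
    (hb : ∀ x y z, b x (y * z) = b x y + b x z) (hsymm : ∀ x y, b x y = b y x)
    {T : Set (MulAut P)} (hT : ∀ φ ∈ T, ∀ x, f (φ x) = f x)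
    (hgen : ∀ W : Subgroup P, (∀ φ ∈ T, ∀ x, φ x * x⁻¹ ∈ W) → W = ⊤)
    (hQ : ∀ x y, f x = 1 → f y = 1 → f (x * y) ≠ 1) (x : P) : f x = 0 := by
  have two : ∀ t : ZMod 2, t = 0 ∨ t = 1 := by decide
  -- An additive map invariant under `T` vanishes.
  have hinv : ∀ l : P → ZMod 2, (∀ u v, l (u * v) = l u + l v) →
      (∀ φ ∈ T, ∀ u, l (φ u) = l u) → ∀ u, l u = 0 := by
    intro l hl hφ u
    let L : P →* Multiplicative (ZMod 2) := MonoidHom.mk' (fun u => Multiplicative.ofAdd (l u))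
      fun u v => by rw [hl, ofAdd_add]
    have hL : L.ker = ⊤ := hgen _ fun φ h u => by
      have e : L (φ u) = L u := congrArg Multiplicative.ofAdd (hφ φ h u)
      rw [MonoidHom.mem_ker, map_mul, map_inv, e, mul_inv_cancel]
    exact (MonoidHom.mem_ker.mp (hL.ge (Subgroup.mem_top u)) : L u = 1)
  by_contra hx0
  have hx := (two (f x)).resolve_left hx0
  have hbφ : ∀ φ ∈ T, ∀ u v, b (φ u) (φ v) = b u v := by
    intro φ h u v
    have h1 := hT φ h (u * v)
    rw [map_mul, hf, hf, hT φ h, hT φ h] at h1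
    exact add_left_cancel h1
  have hS : ∀ u v, f u = 1 → f v = 1 → b u v = 0 := by
    intro u v hu hv
    have h1 := hQ u v hu hv
    rw [hf, hu, hv] at h1
    generalize b u v = t at *
    revert t
    decide
  have hS2 : ∀ u v w, f u = 1 → f v = 1 → b u w = 0 → b v w = 0 := by
    intro u v w hu hv huw
    rcases two (f w) with hw | hw
    · have h1 : f (u * w) = 1 := by rw [hf, hu, hw, huw]; rfl
      have h2 := hS v (u * w) hv h1
      rwa [hb, hS v u hv hu, zero_add] at h2
    · exact hS v w hv hw
  have hb0 : ∀ u, f u = 1 → ∀ w, b u w = 0 := by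
    intro u hu
    refine hinv (b u) (hb u) fun φ h w => ?_
    rw [← hbφ φ h u w]
    have hu' : f (φ u) = 1 := by rw [hT φ h, hu]
    have h1 := hS2 u (φ u) (φ w) hu hu'
    have h2 := hS2 (φ u) u (φ w) hu' hu
    rcases two (b u (φ w)) with h3 | h3
    · rw [h3, h1 h3]
    · rcases two (b (φ u) (φ w)) with h4 | h4
      · rw [h4, h2 h4]
      · rw [h3, h4]
  have hb1 : ∀ u w, b u w = 0 := by
    intro u w
    rcases two (f u) with hu | hu
    · have h1 : f (u * x) = 1 := by rw [hf, hu, hx, hsymm, hb0 x hx]; rfl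
      have h2 := hb0 _ h1 w
      rwa [hsymm, hb, hsymm w x, hb0 x hx, add_zero, hsymm] at h2
    · exact hb0 u hu w
  exact hx0 (hinv f (fun u v => by rw [hf, hb1, add_zero]) hT x)

/-- An element of a finite abelian subgroup that is not a square in it lies outside a subgroup of
index two. -/
theorem exists_index_two_of_not_sq {G : Type*} [Group G] [Finite G] {N : Subgroup G}
    (hN : ∀ a ∈ N, ∀ b ∈ N, Commute a b) {z : G} (hz : z ∈ N) (hsq : ∀ n ∈ N, n ^ 2 ≠ z) :
    ∃ M ≤ N, z ∉ M ∧ (∀ a ∈ N, a ^ 2 ∈ M) ∧ ∀ a ∈ N, ∀ b ∈ N, a ∉ M → b ∉ M → a * b ∈ M := by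
  let S : Subgroup G :=
    { carrier := {x | ∃ n ∈ N, n ^ 2 = x}
      one_mem' := ⟨1, N.one_mem, one_pow 2⟩
      mul_mem' := by
        rintro _ _ ⟨a, ha, rfl⟩ ⟨b, hb, rfl⟩
        exact ⟨a * b, N.mul_mem ha hb, (hN a ha b hb).mul_pow 2⟩
      inv_mem' := by
        rintro _ ⟨a, ha, rfl⟩
        exact ⟨a⁻¹, N.inv_mem ha, inv_pow a 2⟩ }
  have hSN : S ≤ N := by
    rintro _ ⟨a, ha, rfl⟩
    exact N.pow_mem ha 2
  obtain ⟨M, hM, hmax⟩ := Set.Finite.exists_maximal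
    (s := {M : Subgroup G | S ≤ M ∧ M ≤ N ∧ z ∉ M}) (Set.toFinite _)
    ⟨S, le_rfl, hSN, fun ⟨n, hn, h⟩ => hsq n hn h⟩
  obtain ⟨hSM, hMN, hzM⟩ := hM
  have hsqM : ∀ a ∈ N, a ^ 2 ∈ M := fun a ha => hSM ⟨a, ha, rfl⟩
  -- By maximality, `M` and any element of `N` outside `M` generate a subgroup containing `z`.
  have key : ∀ a ∈ N, a ∉ M → a * z ∈ M := by
    intro a ha haM
    let M' : Subgroup G :=
      { carrier := {x | x ∈ M ∨ x ∈ N ∧ x * a ∈ M}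
        one_mem' := Or.inl M.one_mem
        mul_mem' := by
          rintro x y (hx | ⟨hx, hxa⟩) (hy | ⟨hy, hya⟩)
          · exact Or.inl (M.mul_mem hx hy)
          · exact Or.inr ⟨N.mul_mem (hMN hx) hy, by rw [mul_assoc]; exact M.mul_mem hx hya⟩
          · refine Or.inr ⟨N.mul_mem hx (hMN hy), ?_⟩
            rw [mul_assoc, (hN y (hMN hy) a ha).eq, ← mul_assoc]
            exact M.mul_mem hxa hy
          · left
            have e : x * y = x * a * (y * a) * (a ^ 2)⁻¹ := by
              rw [(hN y hy a ha).eq, ← mul_assoc, mul_assoc x, ← pow_two,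
                mul_assoc x, ← (hN y hy _ (N.pow_mem ha 2)).eq]
              group
            rw [e]
            exact M.mul_mem (M.mul_mem hxa hya) (M.inv_mem (hsqM a ha))
        inv_mem' := by
          rintro x (hx | ⟨hx, hxa⟩)
          · exact Or.inl (M.inv_mem hx)
          · refine Or.inr ⟨N.inv_mem hx, ?_⟩
            have e : x⁻¹ * a = (x ^ 2)⁻¹ * (x * a) := by group
            rw [e]
            exact M.mul_mem (M.inv_mem (hsqM x hx)) hxa }
    have haM' : a ∈ M' := Or.inr ⟨ha, by rw [← pow_two]; exact hsqM a ha⟩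
    have hMM' : M ≤ M' := fun x hx => Or.inl hx
    have hzM' : z ∈ M' := by
      by_contra hzM'
      refine haM (hmax ⟨hSM.trans hMM', ?_, hzM'⟩ hMM' haM')
      rintro x (hx | hx)
      exacts [hMN hx, hx.1]
    rw [(hN a ha z hz).eq]
    exact (hzM'.resolve_left hzM).2
  refine ⟨M, hMN, hzM, hsqM, fun a ha b hb haM hbM => ?_⟩
  have e : a * b = a * z * (b * z) * (z ^ 2)⁻¹ := by
    rw [(hN b hb z hz).eq, ← mul_assoc, mul_assoc a, ← pow_two,
      mul_assoc a, ← (hN b hb _ (N.pow_mem hz 2)).eq]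
    group
  rw [e]
  exact M.mul_mem (M.mul_mem (key a ha haM) (key b hb hbM)) (M.inv_mem (hsqM z hz))

end Quaternion

/-! ### The chief factor at the top -/

section TopFactor

open scoped commutatorElement

variable {G : Type*} [Group G]

theorem IsChiefFactor.isMinimalNormal_map {P N : Subgroup G} [N.Normal] (h : IsChiefFactor P N) :
    IsMinimalNormal (P.map (QuotientGroup.mk' N)) where
  normal := h.normal_top.map _ (QuotientGroup.mk'_surjective N)
  ne_bot := by
    rw [Ne, Subgroup.map_eq_bot_iff, QuotientGroup.ker_mk']
    exact h.lt.not_ge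
  minimal := by
    intro M hM hMP
    have hs := QuotientGroup.mk'_surjective N
    have hP : (P.map (QuotientGroup.mk' N)).comap (QuotientGroup.mk' N) = P := by
      rw [Subgroup.comap_map_eq, QuotientGroup.ker_mk', sup_eq_left]
      exact h.lt.le
    rcases h.maximal (M.comap (QuotientGroup.mk' N)) inferInstance
      (by conv_lhs => rw [← QuotientGroup.ker_mk' N]
          exact Subgroup.ker_le_comap _ _) (hP ▸ Subgroup.comap_mono hMP) with h1 | h1
    · left
      rw [← Subgroup.map_comap_eq_self_of_surjective hs M, h1, QuotientGroup.map_mk'_self]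
    · right
      rw [← Subgroup.map_comap_eq_self_of_surjective hs M, h1]

theorem card_map_mk' {P N : Subgroup G} [N.Normal] :
    Nat.card (P.map (QuotientGroup.mk' N)) = N.relIndex P := by
  rw [← Subgroup.relIndex_ker, QuotientGroup.ker_mk']

/-- Modulo `chiefCentralizer N`, the group `G` is abelian of exponent dividing `p - 1`, because each
chief factor below `N` has order `p`. -/
theorem HasPrimeChiefFactors.mem_chiefCentralizer [Finite G] {p : ℕ} (hp : p.Prime) {N : Subgroup G}
    (hN : HasPrimeChiefFactors N) (hNp : IsPGroup p N) (g h : G) :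
    ⁅g, h⁆ ∈ chiefCentralizer N ∧ g ^ (p - 1) ∈ chiefCentralizer N := by
  have key : ∀ c : G, (∀ L K : Subgroup G, ∀ [K.Normal], IsChiefFactor L K → L ≤ N →
      ∀ v ∈ L.map (QuotientGroup.mk' K), Commute (QuotientGroup.mk' K c) v) →
      c ∈ chiefCentralizer N := by
    intro c hc L K hLK hLN x hx
    have := hLK.normal_bot
    rw [← QuotientGroup.eq_one_iff]
    have := hc L K hLK hLN _ (Subgroup.mem_map_of_mem _ hx)
    rw [← commutatorElement_eq_one_iff_commute, ← map_commutatorElement] at this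
    exact this
  have hcard : ∀ L K : Subgroup G, ∀ [K.Normal], IsChiefFactor L K → L ≤ N →
      Nat.card (L.map (QuotientGroup.mk' K)) = p := by
    intro L K _ hLK hLN
    have := Fact.mk hp
    have h1 := hN L K hLK hLN
    rw [← card_map_mk'] at h1
    have h2 : IsPGroup p (L.map (QuotientGroup.mk' K)) := (hNp.to_le hLN).map _
    have h3 := h2.card_eq_or_dvd.resolve_left h1.ne_one
    exact ((Nat.prime_dvd_prime_iff_eq hp h1).mp h3).symm
  constructor
  · refine key _ fun L K _ hLK hLN => ?_
    have := hLK.isMinimalNormal_map.normal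
    refine mem_ker_conjNormal_iff.mp ?_
    rw [MonoidHom.mem_ker, map_commutatorElement, map_commutatorElement]
    exact (mulAut_of_card_prime hp (hcard L K hLK hLN) _ _).1
  · refine key _ fun L K _ hLK hLN => ?_
    have := hLK.isMinimalNormal_map.normal
    refine mem_ker_conjNormal_iff.mp ?_
    rw [MonoidHom.mem_ker, map_pow, map_pow]
    exact (mulAut_of_card_prime hp (hcard L K hLK hLN) _ 1).2

/-- If the centralizer of `N` acts trivially on the chief factor `P / N`, and all chief factors
below `N` have prime order, then `P / N` has prime order. -/
theorem IsChiefFactor.relIndex_eq_of_commutator_le [Finite G] {p : ℕ} (hp : p.Prime)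
    {P N : Subgroup G} (h : IsChiefFactor P N) (hPp : IsPGroup p P) (hN : HasPrimeChiefFactors N)
    (hc : ⁅P, Subgroup.centralizer (N : Set G)⁆ ≤ N) : N.relIndex P = p := by
  have := h.normal_bot
  have hNp : IsPGroup p N := hPp.to_le h.lt.le
  have hV := h.isMinimalNormal_map
  have hmem := hN.mem_chiefCentralizer hp hNp
  have hDn : (chiefCentralizer N).Normal := by
    refine ⟨fun d hd g => ?_⟩
    have e : g * d * g⁻¹ = ⁅g, d⁆ * d := by simp [commutatorElement_def]
    rw [e]
    exact mul_mem (hmem g d).1 hd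
  have hD := hV.commute_of_pow_commute hp (hPp.map _)
    (hDn.map _ (QuotientGroup.mk'_surjective N)) (by
      rintro _ ⟨d, hd, rfl⟩
      obtain ⟨k, m, hm, hkm⟩ := Nat.exists_eq_pow_mul_and_not_dvd (orderOf_pos d).ne' p hp.ne_one
      refine ⟨k, ?_⟩
      rintro _ ⟨x, hx, rfl⟩
      rw [← map_pow]
      have hdk : ¬ p ∣ orderOf (d ^ p ^ k) := by
        rwa [orderOf_pow_of_dvd (pow_ne_zero k hp.ne_zero) (hkm ▸ dvd_mul_right _ _), hkm,
          Nat.mul_div_cancel_left _ (pow_pos hp.pos k)]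
      have hcen : d ^ p ^ k ∈ Subgroup.centralizer (N : Set G) := fun n hn =>
        (commute_of_mem_chiefCentralizer hp this hNp (pow_mem hd _) hdk hn).eq.symm
      have h1 := hc (Subgroup.commutator_mem_commutator hx hcen)
      rw [← QuotientGroup.eq_one_iff] at h1
      refine (commutatorElement_eq_one_iff_commute.mp ?_).symm
      rw [← map_commutatorElement]
      exact h1)
  rw [← card_map_mk']
  refine hV.card_eq_of_abelian_action hp (hPp.map _) ?_ ?_
  · intro g g' v hv
    obtain ⟨g, rfl⟩ := QuotientGroup.mk'_surjective N g
    obtain ⟨g', rfl⟩ := QuotientGroup.mk'_surjective N g'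
    rw [← map_commutatorElement]
    exact hD _ (Subgroup.mem_map_of_mem _ (hmem g g').1) v hv
  · intro g v hv
    obtain ⟨g, rfl⟩ := QuotientGroup.mk'_surjective N g
    rw [← map_pow]
    exact hD _ (Subgroup.mem_map_of_mem _ (hmem g 1).2) v hv

/-- If every coset of `N` in `P` outside `N` contains an element generating a subgroup with the
`𝓛`-`Π`-property, then the chief factor `P / N` has order `p`. Only a coset that is fixed by a
Sylow `p`-subgroup of `G / N` is used. -/
theorem IsChiefFactor.relIndex_eq_of_satisfiesLPiProperty [Finite G] {p : ℕ} (hp : p.Prime)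
    {P N : Subgroup G} (h : IsChiefFactor P N) (hPp : IsPGroup p P)
    (hmax : ∀ M : Subgroup G, M.Normal → M ≤ P → ¬ M ≤ N → M = P)
    (hx : ∀ x ∈ P, x ∉ N → ∃ n ∈ N, SatisfiesLPiProperty (Subgroup.zpowers (x * n))) :
    N.relIndex P = p := by
  have := Fact.mk hp
  have := h.normal_bot
  have hV := h.isMinimalNormal_map
  have hVp : IsPGroup p (P.map (QuotientGroup.mk' N)) := hPp.map _
  obtain ⟨S⟩ : Nonempty (Sylow p (G ⧸ N)) := inferInstance
  obtain ⟨v, hvV, hv1, hv⟩ := exists_commute_of_pow_commute hp hV.normal hVp hV.ne_bot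
    (D := (S : Subgroup (G ⧸ N))) (by
      intro s hs
      obtain ⟨k, hk⟩ := S.isPGroup' ⟨s, hs⟩
      refine ⟨k, fun v _ => ?_⟩
      rw [show s ^ p ^ k = 1 from congrArg Subtype.val hk]
      exact Commute.one_left v)
  obtain ⟨x, hxP, hxv⟩ := id hvV
  have hxN : x ∉ N := fun hxN => hv1 (hxv ▸ (QuotientGroup.eq_one_iff x).mpr hxN)
  obtain ⟨n, hn, hL⟩ := hx x hxP hxN
  have hyv : QuotientGroup.mk' N (x * n) = v := by
    rw [map_mul, hxv, show QuotientGroup.mk' N n = 1 from (QuotientGroup.eq_one_iff n).mpr hn,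
      mul_one]
  have hyP : x * n ∈ P := mul_mem hxP (h.lt.le hn)
  have hyc : x * n ∈ Subgroup.normalClosure (Subgroup.zpowers (x * n) : Set G) :=
    Subgroup.subset_normalClosure (Subgroup.mem_zpowers _)
  have hcl : Subgroup.normalClosure (Subgroup.zpowers (x * n) : Set G) = P := by
    have := h.normal_top
    refine hmax _ inferInstance (Subgroup.normalClosure_le_normal ?_) fun hle => hxN ?_
    · exact SetLike.coe_subset_coe.mpr (Subgroup.zpowers_le.mpr hyP)
    · exact (mul_mem_cancel_right hn).mp (hle hyc)
  have hi := hL N (hcl.symm ▸ h)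
  rw [MonoidHom.map_zpowers, hyv] at hi
  rw [← card_map_mk']
  refine hV.card_eq_of_zpowers_normal hp hVp hvV hv1 (zpowers_normal_of_index_normalizer S hv ?_)
  intro q hq hqd
  have h1 := hi q hq hqd
  obtain ⟨k, hk⟩ := IsPGroup.iff_card.mp (hVp.to_le (Subgroup.zpowers_le.mpr hvV))
  rw [hk] at h1
  exact (Nat.prime_dvd_prime_iff_eq hq hp).mp (hq.dvd_of_dvd_pow h1)

end TopFactor

/-! ### Central extensions of elementary abelian groups -/

section CentralExtension

open scoped commutatorElement

variable {G : Type*} [Group G]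

theorem mul_pow_eq_of_commute_commutator {x y : G} (hx : Commute ⁅y, x⁆ x) (hy : Commute ⁅y, x⁆ y)
    (n : ℕ) : (x * y) ^ n = x ^ n * y ^ n * ⁅y, x⁆ ^ n.choose 2 := by
  induction n with
  | zero => simp
  | succ n ih =>
    have hxy := hx.mul_right hy
    calc (x * y) ^ (n + 1) = x ^ n * (y ^ n * x) * y * ⁅y, x⁆ ^ n.choose 2 := by
          rw [pow_succ, ih, mul_assoc, (hxy.pow_left _).eq]; simp only [mul_assoc]
      _ = x ^ n * (⁅y, x⁆ ^ n * (x * y ^ n * y)) * ⁅y, x⁆ ^ n.choose 2 := by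
          rw [pow_mul_eq_commutator_pow_mul hy]; simp only [mul_assoc]
      _ = x ^ (n + 1) * y ^ (n + 1) * ⁅y, x⁆ ^ (n + 1).choose 2 := by
          rw [mul_assoc x, ← pow_succ y,
            ((hx.pow_left n).mul_right ((hy.pow_left n).pow_right (n + 1))).eq,
            Nat.choose_succ_succ' n 1, Nat.choose_one_right, pow_add ⁅y, x⁆, pow_succ x]
          simp only [mul_assoc]

theorem mul_pow_eq_of_dvd_choose {p e : ℕ} {P N : Subgroup G}
    (hcen : ∀ n ∈ N, ∀ x ∈ P, Commute n x) (hcomm : ∀ x ∈ P, ∀ y ∈ P, ⁅x, y⁆ ∈ N)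
    (hpow : ∀ x ∈ P, x ^ p ∈ N) (he : p ∣ e.choose 2) {x y : G} (hx : x ∈ P) (hy : y ∈ P) :
    (x * y) ^ e = x ^ e * y ^ e := by
  have hc := hcomm y hy x hx
  have h1 : ⁅y, x⁆ ^ p = 1 := by
    have h2 := pow_mul_eq_commutator_pow_mul (hcen _ hc y hy) p
    rw [(hcen _ (hpow y hy) x hx).eq, mul_assoc, right_eq_mul] at h2
    exact h2
  obtain ⟨k, hk⟩ := he
  rw [mul_pow_eq_of_commute_commutator (hcen _ hc x hx) (hcen _ hc y hy), hk, pow_mul, h1, one_pow,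
    mul_one]

/-- The homomorphism `x ↦ x ^ e` from `P` to `N` is constant on the orbits of the centralizer of
`N`, hence trivial. -/
theorem pow_eq_one_of_commutator_eq {p e : ℕ} {P N : Subgroup G} (hP : P.Normal)
    (hcen : ∀ n ∈ N, ∀ x ∈ P, Commute n x) (hcomm : ∀ x ∈ P, ∀ y ∈ P, ⁅x, y⁆ ∈ N)
    (hpow : ∀ x ∈ P, x ^ p ∈ N) (hgen : ⁅P, Subgroup.centralizer (N : Set G)⁆ = P)
    (hpe : p ∣ e) (he : p ∣ e.choose 2) {x : G} (hx : x ∈ P) : x ^ e = 1 := by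
  let W : Subgroup G :=
    { carrier := {x | x ∈ P ∧ x ^ e = 1}
      one_mem' := ⟨P.one_mem, one_pow e⟩
      mul_mem' := fun {a b} ha hb => ⟨P.mul_mem ha.1 hb.1, by
        rw [mul_pow_eq_of_dvd_choose hcen hcomm hpow he ha.1 hb.1, ha.2, hb.2, one_mul]⟩
      inv_mem' := fun {a} ha => ⟨P.inv_mem ha.1, by rw [inv_pow, ha.2, inv_one]⟩ }
  have hW : ⁅P, Subgroup.centralizer (N : Set G)⁆ ≤ W := by
    rw [Subgroup.commutator_le]
    intro x hx a ha
    have e1 : ⁅x, a⁆ = x * (a * x * a⁻¹)⁻¹ := by simp only [commutatorElement_def]; group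
    have h1 : a * x * a⁻¹ ∈ P := hP.conj_mem x hx a
    have h2 : x ^ e ∈ N := by
      obtain ⟨k, rfl⟩ := hpe
      rw [pow_mul]
      exact pow_mem (hpow x hx) k
    rw [e1]
    refine ⟨mul_mem hx (inv_mem h1), ?_⟩
    rw [mul_pow_eq_of_dvd_choose hcen hcomm hpow he hx (inv_mem h1), inv_pow, conj_pow, ← ha _ h2,
      mul_inv_cancel_right, mul_inv_cancel]
  exact (hW (hgen.ge hx)).2

/-- In the quaternion-free case the squares of elements of `P` are squares of elements of `N`:
otherwise, modulo a suitable subgroup of `N` of index two, squaring is a nonzero quadratic form on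
`P / N`, invariant under the centralizer of `N`. -/
theorem exists_mul_sq_eq_one [Finite G] {P N : Subgroup G} (hP : P.Normal) (hNP : N ≤ P)
    (hcen : ∀ n ∈ N, ∀ x ∈ P, Commute n x) (hcomm : ∀ x ∈ P, ∀ y ∈ P, ⁅x, y⁆ ∈ N)
    (hpow : ∀ x ∈ P, x ^ 2 ∈ N) (hgen : ⁅P, Subgroup.centralizer (N : Set G)⁆ = P)
    (hQ : IsQuaternionFree P) {x : G} (hx : x ∈ P) : ∃ n ∈ N, (x * n) ^ 2 = 1 := by
  by_contra! hne
  obtain ⟨M, hMN, hxM, hsqM, hM⟩ := exists_index_two_of_not_sq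
    (fun a ha b hb => hcen a ha b (hNP hb)) (hpow x hx) (fun n hn h => by
      refine hne n⁻¹ (inv_mem hn) ?_
      rw [((hcen _ (inv_mem hn) x hx).symm).mul_pow, inv_pow, h, mul_inv_cancel])
  classical
  let δ : G → ZMod 2 := fun g => if g ∈ M then 0 else 1
  have hδ : ∀ a ∈ N, ∀ b ∈ N, δ (a * b) = δ a + δ b := by
    intro a ha b hb
    by_cases h1 : a ∈ M
    · simp [δ, h1, Subgroup.mul_mem_cancel_left M h1]
    · by_cases h2 : b ∈ M
      · simp [δ, h1, h2, Subgroup.mul_mem_cancel_right M h2]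
      · simp only [δ, h1, h2, hM a ha b hb h1 h2, if_true, if_false]
        rfl
  have hδ1 : ∀ g, δ g = 1 ↔ g ∉ M := by
    intro g
    by_cases h : g ∈ M <;> simp [δ, h]
  have hMn : (M.subgroupOf P).Normal := by
    refine ⟨fun m hm g => ?_⟩
    rw [Subgroup.mem_subgroupOf] at hm ⊢
    rwa [Subgroup.coe_mul, Subgroup.coe_mul, Subgroup.coe_inv,
      ← (hcen _ (hMN hm) g g.2).eq, mul_inv_cancel_right]
  refine (hδ1 _).mpr hxM ▸ (one_ne_zero (α := ZMod 2)) <| quadratic_eq_zero_of_invariant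
    (P := P) (f := fun u => δ ((u : G) ^ 2)) (b := fun u v => δ ⁅(v : G), (u : G)⁆)
    (T := {φ | ∃ a ∈ Subgroup.centralizer (N : Set G), φ = MulAut.conjNormal a})
    ?_ ?_ ?_ ?_ ?_ ?_ ⟨x, hx⟩
  · intro u v
    have hc := hcomm v v.2 u u.2
    have h1 := mul_pow_eq_of_commute_commutator (hcen _ hc u u.2) (hcen _ hc v v.2) 2
    rw [Nat.choose_self, pow_one] at h1
    rw [Subgroup.coe_mul, h1, hδ _ (mul_mem (hpow u u.2) (hpow v v.2)) _ hc,
      hδ _ (hpow u u.2) _ (hpow v v.2)]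
  · intro u v w
    have e : ⁅(v : G) * w, (u : G)⁆ = v * ⁅(w : G), (u : G)⁆ * (v : G)⁻¹ * ⁅(v : G), (u : G)⁆ := by
      simp only [commutatorElement_def]; group
    rw [Subgroup.coe_mul, e, ← (hcen _ (hcomm w w.2 u u.2) v v.2).eq, mul_inv_cancel_right,
      hδ _ (hcomm w w.2 u u.2) _ (hcomm v v.2 u u.2), add_comm]
  · intro u v
    dsimp only [δ]
    rw [← commutatorElement_inv, Subgroup.inv_mem_iff]
  · rintro _ ⟨a, ha, rfl⟩ u
    rw [MulAut.conjNormal_apply, conj_pow, ← ha _ (hpow u u.2), mul_inv_cancel_right]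
  · intro W hW
    have hle : ⁅P, Subgroup.centralizer (N : Set G)⁆ ≤ W.map P.subtype := by
      rw [Subgroup.commutator_le]
      intro u hu a ha
      refine ⟨_, inv_mem (hW _ ⟨a, ha, rfl⟩ ⟨u, hu⟩), ?_⟩
      rw [Subgroup.subtype_apply, Subgroup.coe_inv, Subgroup.coe_mul, MulAut.conjNormal_apply,
        Subgroup.coe_inv, commutatorElement_def]
      group
    rw [hgen] at hle
    refine eq_top_iff.mpr fun u _ => ?_
    obtain ⟨w, hw, hwu⟩ := hle u.2
    rwa [← Subtype.ext (a1 := w) (a2 := u) hwu]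
  · intro u v hu hv huv
    rw [hδ1] at hu hv huv
    have hmem : ∀ g ∈ P, ∀ h ∈ P, g ^ 2 ∉ M → h ^ 2 ∉ M → (g ^ 2)⁻¹ * h ^ 2 ∈ M :=
      fun g hg h hh h1 h2 => hM _ (inv_mem (hpow g hg)) _ (hpow h hh)
        (fun h3 => h1 (inv_mem_iff.mp h3)) h2
    obtain ⟨F, hF⟩ := exists_injective_quaternionGroup
      (x := QuotientGroup.mk' (M.subgroupOf P) u) (y := QuotientGroup.mk' (M.subgroupOf P) v)
      (by
        rw [← map_pow]
        exact fun h => hu (Subgroup.mem_subgroupOf.mp ((QuotientGroup.eq_one_iff _).mp h)))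
      (by
        rw [← map_pow]
        refine (QuotientGroup.eq_one_iff _).mpr (Subgroup.mem_subgroupOf.mpr ?_)
        rw [Subgroup.coe_pow, show 4 = 2 * 2 from rfl, pow_mul]
        exact hsqM _ (hpow u u.2))
      (by
        rw [← map_pow, ← map_pow]
        exact QuotientGroup.eq.mpr (Subgroup.mem_subgroupOf.mpr (hmem v v.2 u u.2 hv hu)))
      (by
        rw [← map_mul, ← map_pow, ← map_pow]
        exact QuotientGroup.eq.mpr
          (Subgroup.mem_subgroupOf.mpr (hmem (u * v) (u * v).2 u u.2 huv hu)))
    exact not_isQuaternionFree_of_quotient _ hF hQ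

end CentralExtension

/-! ### The supersoluble hypercenter -/

section Hypercenter

open scoped commutatorElement

variable {G : Type*} [Group G]

/-- Under the hypotheses on `P`, every coset of `N` in `P` outside `N` contains an element that
generates a subgroup with the `𝓛`-`Π`-property, provided that `P` is its own commutator with the
centralizer of `N`. -/
theorem exists_satisfiesLPiProperty_zpowers_mul [Finite G] {p : ℕ} (hp : p.Prime)
    {P N : Subgroup G} (hP : P.Normal) (hNP : N ≤ P) (hcen : ∀ n ∈ N, ∀ x ∈ P, Commute n x)
    (hcomm : ∀ x ∈ P, ∀ y ∈ P, ⁅x, y⁆ ∈ N) (hpow : ∀ x ∈ P, x ^ p ∈ N)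
    (hgen : ⁅P, Subgroup.centralizer (N : Set G)⁆ = P)
    (h1 : ∀ H : Subgroup G, H ≤ P → Nat.card H = p → SatisfiesLPiProperty H)
    (h2 : ¬ IsQuaternionFree P →
      ∀ H : Subgroup G, H ≤ P → IsCyclic H → Nat.card H = 4 → SatisfiesLPiProperty H)
    {x : G} (hx : x ∈ P) (hxN : x ∉ N) :
    ∃ n ∈ N, SatisfiesLPiProperty (Subgroup.zpowers (x * n)) := by
  have := Fact.mk hp
  have hne : ∀ n ∈ N, x * n ≠ 1 := fun n hn h =>
    hxN ((mul_mem_cancel_right hn).mp (h ▸ N.one_mem))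
  have key : ∀ n ∈ N, (x * n) ^ p = 1 → SatisfiesLPiProperty (Subgroup.zpowers (x * n)) := by
    intro n hn h
    refine h1 _ (Subgroup.zpowers_le.mpr (mul_mem hx (hNP hn))) ?_
    rw [Nat.card_zpowers]
    exact orderOf_eq_prime h (hne n hn)
  rcases hp.eq_two_or_odd' with rfl | hodd
  · by_cases hQ : IsQuaternionFree P
    · obtain ⟨n, hn, h⟩ := exists_mul_sq_eq_one hP hNP hcen hcomm hpow hgen hQ hx
      exact ⟨n, hn, key n hn h⟩
    · refine ⟨1, N.one_mem, ?_⟩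
      by_cases hx2 : x ^ 2 = 1
      · exact key 1 N.one_mem (by rwa [mul_one])
      have hx4 : x ^ 4 = 1 := pow_eq_one_of_commutator_eq hP hcen hcomm hpow hgen
        (by decide) (by decide) hx
      rw [mul_one]
      refine h2 hQ _ (Subgroup.zpowers_le.mpr hx) inferInstance ?_
      rw [Nat.card_zpowers]
      have h3 : orderOf x = 2 ^ (1 + 1) :=
        orderOf_eq_prime_pow (by simpa using hx2) (by simpa using hx4)
      simpa using h3
  · have hch : p ∣ p.choose 2 :=
      hp.dvd_choose_self two_ne_zero (lt_of_le_of_ne hp.two_le fun h => by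
        rw [← h] at hodd
        exact absurd hodd (by decide))
    refine ⟨1, N.one_mem, key 1 N.one_mem ?_⟩
    rw [mul_one]
    exact pow_eq_one_of_commutator_eq hP hcen hcomm hpow hgen dvd_rfl hch hx

theorem hasPrimeChiefFactors_of_satisfiesLPiProperty [Finite G] {p : ℕ} (hp : p.Prime)
    (P : Subgroup G) (hPn : P.Normal) (hPp : IsPGroup p P)
    (h1 : ∀ H : Subgroup G, H ≤ P → Nat.card H = p → SatisfiesLPiProperty H)
    (h2 : ¬ IsQuaternionFree P →
      ∀ H : Subgroup G, H ≤ P → IsCyclic H → Nat.card H = 4 → SatisfiesLPiProperty H) :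
    HasPrimeChiefFactors P := by
  induction hc : Nat.card P using Nat.strong_induction_on generalizing P with
  | _ c ih =>
  have hsmall : ∀ M : Subgroup G, M.Normal → M < P → HasPrimeChiefFactors M := by
    intro M hM hlt
    refine ih _ (hc ▸ Set.Finite.card_lt_card (Set.toFinite _) hlt) M hM (hPp.to_le hlt.le)
      (fun H hH => h1 H (hH.trans hlt.le)) (fun hQ H hH => h2 (fun hQP => hQ ?_) H
        (hH.trans hlt.le)) rfl
    exact hQP.of_injective (Subgroup.inclusion_injective hlt.le)
  by_cases hb : P = ⊥
  · intro L K hLK hL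
    rw [hb] at hL
    exact absurd (hLK.lt.trans_le hL) not_lt_bot
  obtain ⟨N, hN⟩ := exists_isChiefFactor hPn hb
  have hNn := hN.normal_bot
  have hNprime := hsmall N hNn hN.lt
  refine hNprime.of_isChiefFactor hN ?_
  by_contra hnot
  -- A normal subgroup `M < P` outside `N` would give `P / N ≅ M / (M ∩ N)`.
  have hmax : ∀ M : Subgroup G, M.Normal → M ≤ P → ¬ M ≤ N → M = P := by
    intro M hM hMP hMN
    by_contra hne
    have hsup : N ⊔ M = P :=
      (hN.maximal _ inferInstance le_sup_left (sup_le hN.lt.le hMP)).resolve_left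
        fun h => hMN (h ▸ le_sup_right)
    refine hnot ?_
    rw [← hN.relIndex_inf_of_sup_eq hsup]
    exact hsmall M hM (lt_of_le_of_ne hMP hne) _ _ (hN.inf_of_sup_eq hM hsup) le_rfl
  have hgen : ⁅P, Subgroup.centralizer (N : Set G)⁆ = P := by
    refine hmax _ inferInstance (Subgroup.commutator_le_left _ _) fun hle => hnot ?_
    rw [hN.relIndex_eq_of_commutator_le hp hPp hNprime hle]
    exact hp
  -- The three subgroups lemma for `P`, `C_G(N)` and `N`.
  have hbot : ⁅N, Subgroup.centralizer (N : Set G)⁆ = ⊥ := by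
    rw [Subgroup.commutator_comm]
    exact Subgroup.commutator_eq_bot_iff_le_centralizer.mpr le_rfl
  have hcen : ∀ n ∈ N, ∀ x ∈ P, Commute n x := by
    have h3 : ⁅⁅P, Subgroup.centralizer (N : Set G)⁆, N⁆ = ⊥ := by
      refine Subgroup.commutator_commutator_eq_bot_of_rotate ?_ ?_
      · rw [Subgroup.commutator_comm _ N, hbot, Subgroup.commutator_bot_left]
      · refine eq_bot_iff.mpr (le_trans (Subgroup.commutator_mono ?_ le_rfl) hbot.le)
        exact Subgroup.commutator_le_left _ _
    rw [hgen, Subgroup.commutator_eq_bot_iff_le_centralizer] at h3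
    exact fun n hn x hx => h3 hx n hn
  have hV := hN.isMinimalNormal_map
  have hVp : IsPGroup p (P.map (QuotientGroup.mk' N)) := hPp.map _
  have hcomm : ∀ x ∈ P, ∀ y ∈ P, ⁅x, y⁆ ∈ N := by
    intro x hx y hy
    have := hV.commute hp hVp (Subgroup.mem_map_of_mem _ hx) (Subgroup.mem_map_of_mem _ hy)
    rw [← commutatorElement_eq_one_iff_commute, ← map_commutatorElement] at this
    exact (QuotientGroup.eq_one_iff _).mp this
  have hpow : ∀ x ∈ P, x ^ p ∈ N := by
    intro x hx
    have := hV.pow_eq_one hp hVp (Subgroup.mem_map_of_mem _ hx)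
    rw [← map_pow] at this
    exact (QuotientGroup.eq_one_iff _).mp this
  refine hnot ?_
  rw [hN.relIndex_eq_of_satisfiesLPiProperty hp hPp hmax fun x hx hxN =>
    exists_satisfiesLPiProperty_zpowers_mul hp hPn hN.lt.le hcen hcomm hpow hgen h1 h2 hx hxN]
  exact hp

end Hypercenter

theorem mainTheorem3 {G : Type*} [Group G] [Finite G] (p : ℕ) (hp : p.Prime)
    (P : Subgroup G) (hPn : P.Normal) (hPp : IsPGroup p P)
    (h1 : ∀ H : Subgroup G, H ≤ P → Nat.card H = p → SatisfiesLPiProperty H)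
    (h2 : ¬ IsQuaternionFree P →
      ∀ H : Subgroup G, H ≤ P → IsCyclic H → Nat.card H = 4 → SatisfiesLPiProperty H) :
    P ≤ supersolubleHypercenter G :=
  le_sSup ⟨hPn, hasPrimeChiefFactors_of_satisfiesLPiProperty hp P hPn hPp h1 h2⟩
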